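/- **Definitions.** A *clan* is a category $\mathcal{E}$ with a terminal object $1$, equipped with a class of maps, called *fibrations*, which contains the isomorphisms and all maps $X\to 1$, is closed under composition, and is closed under base change (the pullback of a fibration along an arbitrary map exists and is a fibration). For an object $A$ of $\mathcal{E}$, the *local clan* $\mathcal{E}(A)$ is the full subcategory of $\mathcal{E}/A$ whose objects are the fibrations with codomain $A$; a map of $\mathcal{E}(A)$ is a fibration if the underlying map of $\mathcal{E}$ is. A *morphism of clans* is a functor that takes fibrations to fibrations, preserves base changes of fibrations, and takes terminal objects to terminal objects; such an $F:\mathcal{E}\to\mathcal{R}$ induces functors $F_{(A)}:\mathcal{E}(A)\to\mathcal{R}(FA)$, $(E,p)\mapsto (FE,F(p))$. A clan $\mathcal{E}$ is a *$\pi$-clan* if for all fibrations $p:E\to A$ and $f:A\to B$ there is an internal product $\Pi_f(E,p)\to B$ (an object of $\mathcal{E}/B$ with a map $\epsilon:f^\star\Pi_f(E,p)\to (E,p)$ in $\mathcal{E}/A$ which is cofree with respect to $f^\star:\mathcal{E}/B\to\mathcal{E}/A$) whose structure map to $B$ is a fibration. A morphism of clans $F$ between $\pi$-clans is *$\pi$-closed*,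 or a *morphism of $\pi$-clans*, if for every object $A$ the functor $F_{(A)}$ is cartesian closed, that is, preserves finite products and exponentials. An *element* $a:X$ of an object $X$ is a map $a:1\to X$. For $\pi$-clans $\mathcal{E},\mathcal{R}$ let $\mathrm{Hom}_\pi(\mathcal{E},\mathcal{R})$ be the groupoid of $\pi$-closed morphisms $\mathcal{E}\to\mathcal{R}$ and natural isomorphisms. For $A\in\mathcal{E}$ let $\mathrm{Hom}_\pi(\mathcal{E},\mathcal{R})_A$ be the groupoid whose objects are the pairs $(F,a)$ of a $\pi$-closed morphism $F:\mathcal{E}\to\mathcal{R}$ and an element $a:F(A)$, and whose maps $(F,a)\to(G,b)$ are the natural isomorphisms $\phi:F\to G$ with $\phi_A(a)=b$. A morphism of $\pi$-clans $e:\mathcal{E}\to\mathcal{E}'$ is *freely generated* by an element $x:e(A)$ if for every $\pi$-clan $\mathcal{R}$ the functor $$\mathrm{Hom}_\pi(\mathcal{E}',\mathcal{R})\to\mathrm{Hom}_\pi(\mathcal{E},\mathcal{R})_A,\qquad H\mapsto (H\circ e,\ H(x))$$ is an equivalence of categories (where $H(1)$ is identified with $1$). **Theorem.** Let $A$ be an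 object of a $\pi$-clan $\mathcal{E}$. Then the local clan $\mathcal{E}(A)$ is a $\pi$-clan, the base change functor $e_A:\mathcal{E}\to\mathcal{E}(A)$, $X\mapsto (A\times X,p_1)$, is a morphism of $\pi$-clans, and $e_A$ is freely generated, as a morphism of $\pi$-clans, by the element $\delta_A:e_A(A)$ given by the diagonal $A\to A\times A$. That is, $\mathcal{E}(A)=\mathcal{E}[\delta_A]$. -/

import Mathlib

open CategoryTheory CategoryTheory.Limits

universe w₂ w₁ v₃ v₂ v₁ u₃ u₂ u₁

-- So that `X ⟶ Y` is elaborated with the quiver structure that is part of a category.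
attribute [-instance] CategoryTheory.catToReflQuiver

/-! ## Clans -/

/-- A clan: a category with a terminal object, equipped with a class `fib` of maps (the
fibrations) that contains the isomorphisms, is closed under composition, consists of carrable
maps, is stable under base change along arbitrary maps, and contains every map to the terminal
object. -/
class Clan (C : Type u₁) [Category.{v₁} C] where
  /-- the class of fibrations -/
  fib : MorphismProperty C
  hasTerminal : HasTerminal C
  fib_of_isIso : ∀ {X Y : C} (f : X ⟶ Y), IsIso f → fib f
  fib_comp : ∀ {X Y Z : C} (f : X ⟶ Y) (g : Y ⟶ Z), fib f → fib g → fib (f ≫ g)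
  carrable : ∀ {X A B : C} (p : X ⟶ B) (f : A ⟶ B), fib p → HasPullback p f
  fib_baseChange : ∀ {W X A B : C} {p₂ : W ⟶ X} {p₁ : W ⟶ A} {p : X ⟶ B} {f : A ⟶ B},
    IsPullback p₂ p₁ p f → fib p → fib p₁
  fib_toTerminal : ∀ X : C, fib (terminal.from X)

namespace Clan

section Basic

variable {C : Type u₁} [Category.{v₁} C] [Clan C]

instance : HasTerminal C := hasTerminal

instance : (fib : MorphismProperty C).IsMultiplicative where
  id_mem _ := fib_of_isIso _ inferInstance
  comp_mem f g hf hg := fib_comp f g hf hg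

instance : HasBinaryProducts C :=
  have _ (X Y : C) : HasBinaryProduct X Y :=
    have := carrable (terminal.from X) (terminal.from Y) (fib_toTerminal X)
    have sq := IsPullback.of_hasPullback (terminal.from X) (terminal.from Y)
    ⟨⟨⟨BinaryFan.mk (pullback.fst (terminal.from X) (terminal.from Y)) (pullback.snd _ _),
      isBinaryProductOfIsTerminalIsPullback _ _ terminalIsTerminal
        (terminal.from X) (terminal.from Y) sq.isLimit⟩⟩⟩
  hasBinaryProducts_of_hasLimit_pair C

/-- The first projection of a cartesian product is a fibration. -/
theorem fib_prodFst (A X : C) : fib (prod.fst : A ⨯ X ⟶ A) := by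
  have h : IsPullback (prod.snd : A ⨯ X ⟶ X) prod.fst (terminal.from X) (terminal.from A) :=
    (IsPullback.of_is_product (prodIsProd A X) terminalIsTerminal).flip
  exact fib_baseChange h (fib_toTerminal X)

end Basic

/-! ## Local clans -/

section Loc

variable {C : Type u₁} [Category.{v₁} C] [Clan C]

/-- The local clan at `A`: the full subcategory of the slice category over `A` whose objects are
the fibrations with codomain `A`. -/
abbrev Loc (A : C) : Type (max u₁ v₁) := (fib : MorphismProperty C).Over ⊤ A

/-- The fibration `X ⟶ A` that an object `X` of the local clan at `A` consists of. -/
abbrev Loc.str {A : C} (X : Loc A) : X.left ⟶ A := X.hom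

/-- The object of the local clan at `A` given by a fibration. -/
abbrev Loc.mk {A X : C} (p : X ⟶ A) (hp : fib p) : Loc A := MorphismProperty.Over.mk ⊤ p hp

/-- The morphism of the local clan at `A` given by a map over `A`. -/
abbrev Loc.homMk {A : C} {X Y : Loc A} (f : X.left ⟶ Y.left) (h : f ≫ Y.str = X.str) : X ⟶ Y :=
  MorphismProperty.Over.homMk f h trivial

theorem Loc.w {A : C} {X Y : Loc A} (f : X ⟶ Y) : f.left ≫ Y.str = X.str :=
  MorphismProperty.Over.w f

theorem Loc.ext {A : C} {X Y : Loc A} {f g : X ⟶ Y} (h : f.left = g.left) : f = g :=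
  MorphismProperty.Over.Hom.ext h

theorem Loc.isIso_left {A : C} {X Y : Loc A} (f : X ⟶ Y) [IsIso f] : IsIso f.left :=
  inferInstanceAs
    (IsIso ((MorphismProperty.Over.forget (fib : MorphismProperty C) ⊤ A ⋙ Over.forget A).map f))

/-- A square of the local clan whose underlying square is a pullback is a pullback. -/
theorem Loc.isPullback {A : C} {W X Y Z : Loc A} {a : W ⟶ X} {b : W ⟶ Y} {p : X ⟶ Z} {q : Y ⟶ Z}
    (h : IsPullback a.left b.left p.left q.left) : IsPullback a b p q := by
  have hw : a ≫ p = b ≫ q := Loc.ext h.w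
  have hs (s : PullbackCone p q) : s.fst.left ≫ p.left = s.snd.left ≫ q.left :=
    congrArg (fun t => t.left) s.condition
  refine ⟨⟨hw⟩, ⟨PullbackCone.IsLimit.mk hw
    (fun s => Loc.homMk (h.lift s.fst.left s.snd.left (hs s)) ?_)
    (fun s => Loc.ext (h.lift_fst _ _ (hs s))) (fun s => Loc.ext (h.lift_snd _ _ (hs s))) ?_⟩⟩
  · have h1 := Loc.w a
    have h2 := Loc.w s.fst
    have h3 := h.lift_fst _ _ (hs s)
    rw [← h1, ← h2, ← Category.assoc, h3]
  · intro s m h1 h2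
    refine Loc.ext (h.hom_ext ?_ ?_)
    · exact (congrArg (fun t => t.left) h1).trans (h.lift_fst _ _ (hs s)).symm
    · exact (congrArg (fun t => t.left) h2).trans (h.lift_snd _ _ (hs s)).symm

/-- The base change of a map of the local clan whose underlying map is a fibration. -/
theorem Loc.exists_isPullback {A : C} {X Y Z : Loc A} (p : X ⟶ Z) (q : Y ⟶ Z)
    (hp : fib p.left) :
    ∃ (W : Loc A) (a : W ⟶ X) (b : W ⟶ Y), IsPullback a b p q ∧ fib b.left := by
  have := carrable p.left q.left hp
  have sq := IsPullback.of_hasPullback p.left q.left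
  have hb : fib (pullback.snd p.left q.left) := fib_baseChange sq hp
  have h : pullback.fst p.left q.left ≫ X.str = pullback.snd p.left q.left ≫ Y.str := by
    rw [← Loc.w p, ← Loc.w q, ← Category.assoc, sq.w, Category.assoc]
  let W : Loc A := Loc.mk (pullback.snd p.left q.left ≫ Y.str) (fib_comp _ _ hb Y.prop)
  let a : W ⟶ X := Loc.homMk (pullback.fst p.left q.left) h
  let b : W ⟶ Y := Loc.homMk (pullback.snd p.left q.left) rfl
  exact ⟨W, a, b, Loc.isPullback sq, hb⟩

/-- The local clan at `A` is a clan: a map over `A` is a fibration if the underlying map is. -/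
instance (A : C) : Clan (Loc A) where
  fib _ _ f := fib f.left
  hasTerminal := inferInstance
  fib_of_isIso f _ := fib_of_isIso _ (Loc.isIso_left f)
  fib_comp f g hf hg := fib_comp f.left g.left hf hg
  carrable p f hp := by
    obtain ⟨W, a, b, h, -⟩ := Loc.exists_isPullback p f hp
    exact h.hasPullback
  fib_baseChange {W X Y Z p₂ p₁ p f} sq hp := by
    obtain ⟨W', a, b, h, hb⟩ := Loc.exists_isPullback p f hp
    let e : W ≅ W' := sq.isoIsPullback _ _ h
    have h1 : e.hom ≫ b = p₁ := sq.isoIsPullback_hom_snd _ _ h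
    rw [← h1]
    exact fib_comp e.hom.left b.left (fib_of_isIso _ (Loc.isIso_left e.hom)) hb
  fib_toTerminal X := by
    let T : Loc A := Loc.mk (𝟙 A) (MorphismProperty.id_mem _ A)
    let s : X ⟶ T := Loc.homMk X.str (Category.comp_id X.str)
    let e : T ≅ ⊤_ (Loc A) :=
      (MorphismProperty.Over.mkIdTerminal (fib : MorphismProperty C) A).uniqueUpToIso
        terminalIsTerminal
    have h1 : terminal.from X = s ≫ e.hom := Subsingleton.elim _ _
    rw [h1]
    exact fib_comp s.left e.hom.left X.prop (fib_of_isIso _ (Loc.isIso_left e.hom))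

/-- The base change functor `e_A : C ⥤ C(A)` along `A ⟶ 1`, sending `X` to the projection
`A × X ⟶ A`. -/
noncomputable def baseChange (A : C) : C ⥤ Loc A where
  obj X := Loc.mk (prod.fst : A ⨯ X ⟶ A) (fib_prodFst A X)
  map {X Y} g := Loc.homMk (prod.map (𝟙 A) g : A ⨯ X ⟶ A ⨯ Y)
    ((prod.map_fst (𝟙 A) g).trans (Category.comp_id _))
  map_id _ := Loc.ext prod.map_id_id
  map_comp f g := Loc.ext (prod.map_id_comp f g)

/-- The diagonal `A ⟶ A × A`, as an element `δ_A : 1 ⟶ e_A(A)` of the local clan at `A`. The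
structure map of the terminal object of the local clan is the canonical isomorphism onto `A`. -/
noncomputable def diagElement (A : C) : ⊤_ (Loc A) ⟶ (baseChange A).obj A :=
  Loc.homMk ((⊤_ (Loc A)).str ≫ (diag A : A ⟶ A ⨯ A)) (by
    change ((⊤_ (Loc A)).str ≫ (diag A : A ⟶ A ⨯ A)) ≫ prod.fst = _
    rw [Category.assoc, prod.lift_fst, Category.comp_id])

end Loc

/-! ## Morphisms of clans -/

section Hom

variable {C : Type u₁} [Category.{v₁} C] [Clan C]
variable {D : Type u₂} [Category.{v₂} D] [Clan D]
variable {R : Type u₃} [Category.{v₃} R] [Clan R]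

/-- A morphism of clans: a functor that takes fibrations to fibrations, preserves base changes of
fibrations, and takes terminal objects to terminal objects. -/
structure IsClanHom (F : C ⥤ D) : Prop where
  map_fib : ∀ {X Y : C} (f : X ⟶ Y), fib f → fib (F.map f)
  map_isPullback : ∀ {W X A B : C} {p₂ : W ⟶ X} {p₁ : W ⟶ A} {p : X ⟶ B} {f : A ⟶ B},
    fib p → IsPullback p₂ p₁ p f → IsPullback (F.map p₂) (F.map p₁) (F.map p) (F.map f)
  map_terminal : ∀ {T : C}, IsTerminal T → Nonempty (IsTerminal (F.obj T))

/-- The functor `F_(A) : C(A) ⥤ D(FA)` induced by a morphism of clans, `(E, p) ↦ (FE, F(p))`. -/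
def IsClanHom.loc {F : C ⥤ D} (hF : IsClanHom F) (A : C) : Loc A ⥤ Loc (F.obj A) where
  obj E := Loc.mk (F.map E.str) (hF.map_fib _ E.prop)
  map f := Loc.homMk (F.map f.left) ((F.map_comp _ _).symm.trans (congrArg F.map (Loc.w f)))
  map_id E := Loc.ext (F.map_id E.left)
  map_comp f g := Loc.ext (F.map_comp f.left g.left)

/-- The image `F(x) : 1 ⟶ F(X)` of an element `x : 1 ⟶ X` under a morphism of clans, where `F(1)`
is identified with `1` by the unique isomorphism between them. -/
noncomputable def IsClanHom.mapElement {F : C ⥤ D} (hF : IsClanHom F) {X : C} (x : ⊤_ C ⟶ X) :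
    ⊤_ D ⟶ F.obj X :=
  (hF.map_terminal terminalIsTerminal).some.from (⊤_ D) ≫ F.map x

theorem IsClanHom.comp {F : C ⥤ D} {G : D ⥤ R} (hF : IsClanHom F) (hG : IsClanHom G) :
    IsClanHom (F ⋙ G) where
  map_fib f hf := hG.map_fib _ (hF.map_fib f hf)
  map_isPullback hp h := hG.map_isPullback (hF.map_fib _ hp) (hF.map_isPullback hp h)
  map_terminal hT := hG.map_terminal (hF.map_terminal hT).some

end Hom

/-! ## Exponentials, internal products and π-clans -/

section Exponentials

variable {C : Type u₁} [Category.{v₁} C]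
variable {D : Type u₂} [Category.{v₂} D]

/-- `IsExponential fst snd ε` says that `(P, ε : P × X ⟶ Y)` is an exponential of `Y` by `X`,
where `P × X` is any product `Q` of `P` and `X`, with projections `fst` and `snd`: for every `Z`
and every map `u : Z × X ⟶ Y` there is a unique map `v : Z ⟶ P` with `ε (v × X) = u`. -/
structure IsExponential {P Q X Y : C} (fst : Q ⟶ P) (snd : Q ⟶ X) (ε : Q ⟶ Y) : Prop where
  isProduct : Nonempty (IsLimit (BinaryFan.mk fst snd))
  existsUnique : ∀ {Z W : C} (p : W ⟶ Z) (q : W ⟶ X),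
    IsLimit (BinaryFan.mk p q) → ∀ u : W ⟶ Y,
      ∃! v : Z ⟶ P, ∃ w : W ⟶ Q, w ≫ fst = p ≫ v ∧ w ≫ snd = q ∧ w ≫ ε = u

/-- A functor between cartesian closed categories is cartesian closed if it preserves finite
products and exponentials. The latter says that each comparison map `F[X, Y] ⟶ [FX, FY]` is an
isomorphism, see `isExponential_iff_isIso_comparison`. -/
structure IsCartesianClosedFunctor (F : C ⥤ D) : Prop where
  preservesFiniteProducts : PreservesFiniteProducts F
  map_isExponential : ∀ {P Q X Y : C} {fst : Q ⟶ P} {snd : Q ⟶ X} {ε : Q ⟶ Y},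
    IsExponential fst snd ε → IsExponential (F.map fst) (F.map snd) (F.map ε)

/-- If `(P', ε')` is an exponential of `Y` by `X` and `ψ : P ⟶ P'` is the comparison map defined
by a map `ε : P × X ⟶ Y`, then `(P, ε)` is an exponential if and only if `ψ` is invertible. -/
theorem isExponential_iff_isIso_comparison {P Q P' Q' X Y : C}
    {fst : Q ⟶ P} {snd : Q ⟶ X} {ε : Q ⟶ Y} (hQ : IsLimit (BinaryFan.mk fst snd))
    {fst' : Q' ⟶ P'} {snd' : Q' ⟶ X} {ε' : Q' ⟶ Y} (h' : IsExponential fst' snd' ε')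
    (ψ : P ⟶ P') (χ : Q ⟶ Q') (h₁ : χ ≫ fst' = fst ≫ ψ) (h₂ : χ ≫ snd' = snd)
    (h₃ : χ ≫ ε' = ε) : IsExponential fst snd ε ↔ IsIso ψ := by
  obtain ⟨hQ'⟩ := h'.isProduct
  have ext' {W : C} {a b : W ⟶ Q'} (e1 : a ≫ fst' = b ≫ fst') (e2 : a ≫ snd' = b ≫ snd') :
      a = b := BinaryFan.IsLimit.hom_ext hQ' e1 e2
  have ext {W : C} {a b : W ⟶ Q} (e1 : a ≫ fst = b ≫ fst) (e2 : a ≫ snd = b ≫ snd) :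
      a = b := BinaryFan.IsLimit.hom_ext hQ e1 e2
  constructor
  · intro h
    obtain ⟨φ, ⟨θ, t1, t2, t3⟩, -⟩ := h.existsUnique fst' snd' hQ' ε'
    refine ⟨φ, ?_, ?_⟩
    · refine (h.existsUnique fst snd hQ ε).unique ⟨χ ≫ θ, ?_, ?_, ?_⟩ ⟨𝟙 _, ?_, ?_, ?_⟩
      · rw [Category.assoc, t1, ← Category.assoc, h₁, Category.assoc]
      · rw [Category.assoc, t2, h₂]
      · rw [Category.assoc, t3, h₃]
      all_goals simp
    · refine (h'.existsUnique fst' snd' hQ' ε').unique ⟨θ ≫ χ, ?_, ?_, ?_⟩ ⟨𝟙 _, ?_, ?_, ?_⟩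
      · rw [Category.assoc, h₁, ← Category.assoc, t1, Category.assoc]
      · rw [Category.assoc, h₂, t2]
      · rw [Category.assoc, h₃, t3]
      all_goals simp
  · intro hψ
    refine ⟨⟨hQ⟩, fun {Z W} p q hW u => ?_⟩
    obtain ⟨v', ⟨w', a1, a2, a3⟩, huniq⟩ := h'.existsUnique p q hW u
    obtain ⟨w, b1, b2⟩ := BinaryFan.IsLimit.lift' hQ (p ≫ v' ≫ inv ψ) q
    have b1 : w ≫ fst = p ≫ v' ≫ inv ψ := b1
    have b2 : w ≫ snd = q := b2
    have hw : w ≫ χ = w' := by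
      apply ext'
      · rw [Category.assoc, h₁, ← Category.assoc, b1, a1]
        simp
      · rw [Category.assoc, h₂, b2, a2]
    refine ⟨v' ≫ inv ψ, ⟨w, b1, b2, by rw [← h₃, ← Category.assoc, hw, a3]⟩, ?_⟩
    rintro v ⟨w₀, c1, c2, c3⟩
    have := huniq (v ≫ ψ) ⟨w₀ ≫ χ, by rw [Category.assoc, h₁, ← Category.assoc, c1, Category.assoc],
      by rw [Category.assoc, h₂, c2], by rw [Category.assoc, h₃, c3]⟩
    rw [← this]
    simp

/-- `IsInternalProduct p f q π₁ π₂ ε` says that `(P, q)`, with the evaluation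
`ε : P ×_B A ⟶ E` over `A`, is an internal product `Π_f(E, p)` of `p : E ⟶ A` along `f : A ⟶ B`,
where `P ×_B A` is any fiber product `Q`, with projections `π₁` and `π₂`: for every map
`g : Z ⟶ B` and every map `u : Z ×_B A ⟶ E` over `A` there is a unique map `v : Z ⟶ P` over `B`
with `ε (v ×_B A) = u`. -/
structure IsInternalProduct {E A B P Q : C} (p : E ⟶ A) (f : A ⟶ B) (q : P ⟶ B)
    (π₁ : Q ⟶ P) (π₂ : Q ⟶ A) (ε : Q ⟶ E) : Prop where
  isPullback : IsPullback π₁ π₂ q f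
  eval_comp : ε ≫ p = π₂
  existsUnique : ∀ {Z W : C} (g : Z ⟶ B) (c₁ : W ⟶ Z) (c₂ : W ⟶ A), IsPullback c₁ c₂ g f →
    ∀ u : W ⟶ E, u ≫ p = c₂ →
      ∃! v : Z ⟶ P, v ≫ q = g ∧ ∃ w : W ⟶ Q, w ≫ π₁ = c₁ ≫ v ∧ w ≫ π₂ = c₂ ∧ w ≫ ε = u

end Exponentials

/-- A clan is a π-clan if every fibration has an internal product along every fibration, whose
structure map is a fibration. -/
class IsPiClan (C : Type u₁) [Category.{v₁} C] [Clan C] : Prop where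
  exists_internalProduct : ∀ {E A B : C} (p : E ⟶ A) (f : A ⟶ B), fib p → fib f →
    ∃ (P Q : C) (q : P ⟶ B) (π₁ : Q ⟶ P) (π₂ : Q ⟶ A) (ε : Q ⟶ E),
      IsInternalProduct p f q π₁ π₂ ε ∧ fib q

/-! ## Morphisms of π-clans -/

section PiHom

variable {C : Type u₁} [Category.{v₁} C] [Clan C]
variable {D : Type u₂} [Category.{v₂} D] [Clan D]
variable {R : Type u₃} [Category.{v₃} R] [Clan R]

/-- A functor between π-clans is π-closed, or a morphism of π-clans, if it is a morphism of clans
`F` such that the induced functor `F_(A)` is cartesian closed for every object `A`. -/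
structure IsPiClosed (F : C ⥤ D) : Prop where
  isClanHom : IsClanHom F
  loc_isCartesianClosed : ∀ A : C, IsCartesianClosedFunctor (isClanHom.loc A)

theorem IsPiClosed.comp {F : C ⥤ D} {G : D ⥤ R} (hF : IsPiClosed F) (hG : IsPiClosed G) :
    IsPiClosed (F ⋙ G) where
  isClanHom := hF.isClanHom.comp hG.isClanHom
  loc_isCartesianClosed A :=
    { preservesFiniteProducts :=
        have := (hF.loc_isCartesianClosed A).preservesFiniteProducts
        have := (hG.loc_isCartesianClosed (F.obj A)).preservesFiniteProducts
        comp_preservesFiniteProducts (hF.isClanHom.loc A) (hG.isClanHom.loc (F.obj A))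
      map_isExponential := fun h =>
        (hG.loc_isCartesianClosed (F.obj A)).map_isExponential
          ((hF.loc_isCartesianClosed A).map_isExponential h) }

variable (C D) in
/-- The objects of the groupoid `Hom_π(C, D)`: the π-closed morphisms `C ⥤ D`. -/
structure PiHom [IsPiClan C] [IsPiClan D] where
  /-- the underlying functor -/
  functor : C ⥤ D
  isPiClosed : IsPiClosed functor

variable [IsPiClan C] [IsPiClan D] [IsPiClan R]

/-- The morphisms of `Hom_π(C, D)` (the 2-cells between π-clans) are the natural isomorphisms. -/
instance : Category (PiHom C D) where
  Hom F G := F.functor ≅ G.functor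
  id F := Iso.refl F.functor
  comp φ ψ := φ ≪≫ ψ

/-- The composite `G ∘ F` of morphisms of π-clans. -/
def PiHom.comp (F : PiHom C D) (G : PiHom D R) : PiHom C R :=
  ⟨F.functor ⋙ G.functor, F.isPiClosed.comp G.isPiClosed⟩

variable (D) in
/-- The objects of the groupoid `Hom_π(C, D)_A`: the pairs `(F, a)` of a π-closed morphism
`F : C ⥤ D` and an element `a : 1 ⟶ F(A)`. -/
structure PiHomAt (A : C) where
  /-- the underlying morphism of π-clans -/
  hom : PiHom C D
  /-- the element of `F(A)` -/
  element : ⊤_ D ⟶ hom.functor.obj A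

/-- A morphism `(F, a) ⟶ (G, b)` of `Hom_π(C, D)_A` is a natural isomorphism `φ : F ≅ G` such that
`φ_A(a) = b`. -/
instance (A : C) : Category (PiHomAt D A) where
  Hom F G := { φ : F.hom.functor ≅ G.hom.functor // F.element ≫ φ.hom.app A = G.element }
  id F := ⟨Iso.refl _, by simp⟩
  comp φ ψ := ⟨φ.1 ≪≫ ψ.1, by
    rw [Iso.trans_hom, NatTrans.comp_app, ← Category.assoc, φ.2, ψ.2]⟩

/-- The functor `H ↦ (H ∘ e, H(x))` from `Hom_π(D, R)` to `Hom_π(C, R)_A`, for a morphism of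
π-clans `e : C ⥤ D` and an element `x : 1 ⟶ e(A)`. -/
noncomputable def restriction (e : PiHom C D) {A : C} (x : ⊤_ D ⟶ e.functor.obj A)
    (R : Type u₃) [Category.{v₃} R] [Clan R] [IsPiClan R] : PiHom D R ⥤ PiHomAt R A where
  obj H := ⟨e.comp H, H.isPiClosed.isClanHom.mapElement x⟩
  map {H K} φ := ⟨Functor.isoWhiskerLeft e.functor φ, by
    simp only [IsClanHom.mapElement, PiHom.comp, Functor.isoWhiskerLeft_hom,
      Functor.whiskerLeft_app, Category.assoc]
    rw [φ.hom.naturality x, ← Category.assoc]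
    congr 1
    exact (K.isPiClosed.isClanHom.map_terminal terminalIsTerminal).some.hom_ext _ _⟩
  map_id H := by
    apply Subtype.ext
    apply Iso.ext
    ext X
    rfl
  map_comp φ ψ := by
    apply Subtype.ext
    apply Iso.ext
    ext X
    rfl

/-- The morphism of π-clans `e : C ⥤ D` is freely generated by the element `x : 1 ⟶ e(A)` if the
functor `H ↦ (H ∘ e, H(x))` from `Hom_π(D, R)` to `Hom_π(C, R)_A` is an equivalence of categories
for every π-clan `R`. -/
def IsFreelyGeneratedBy (e : PiHom C D) {A : C} (x : ⊤_ D ⟶ e.functor.obj A) : Prop :=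
  ∀ (R : Type w₂) [Category.{w₁} R] [Clan R] [IsPiClan R], (restriction e x R).IsEquivalence

end PiHom

end Clan

/-!
Two facts about a π-clan carry the proof.

First, the exponentials of a local clan `C(B)` are exponentials of the whole slice over `B`: their
universal property, which a priori concerns only fibrations `Z ⟶ B`, holds for all maps `Z ⟶ B`
(`IsExponentialOver.of_isPiClan`). Indeed, the internal product of `X ×_B Y ⟶ X` along `X ⟶ B` is
an exponential of the slice, and any exponential of `C(B)` is isomorphic to it. Exponentials of
slices are stable under base change along arbitrary maps `B' ⟶ B`
(`IsExponentialOver.baseChange`), and the exponentials of an iterated local clan are those of a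
local clan of `C` (`Loc.isExponentialOver_left`). Finite products in local clans are preserved by all
morphisms of clans, being base changes of fibrations. So the base change functor `e_A` is π-closed,
and so is, for a π-closed `F : C ⥤ R` and an element `a` of `F(A)`, the functor
`a^* F_(A) : C(A) ⥤ R` that sends `(E, p)` to the fiber of `F(p)` at `a`
(`IsPiClosed.fiber_isPiClosed`). The composite of this functor with `e_A` is `F`, and it sends
`δ_A` to `a`; so restriction along `e_A` is essentially surjective.

Second, every object `(E, p)` of `C(A)` is the fiber of `e_A(p)` at `δ_A`, the map
`(E, p) ⟶ e_A(E)` being the graph of `p` (`Loc.isPullback_graph`). As `e_A(p)` is a fibration, a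
morphism of clans `K` preserves this fiber, and the image of the graph is a monomorphism because
`K(δ_A)` has a terminal domain. So a natural transformation `H ⟶ K` is determined by its
restriction along `e_A`, and any natural transformation between the restrictions that is compatible
with `δ_A` extends: restriction along `e_A` is fully faithful.
-/

namespace Clan

/-! ### Pullbacks and products in local clans -/

section LocalPullbacks

variable {C : Type u₁} [Category.{v₁} C] [Clan C]

theorem Loc.comp_str {A T : C} {X Y : Loc A} (f : X ⟶ Y) {s : T ⟶ X.left} {t : T ⟶ Y.left}
    (h : s ≫ f.left = t) : s ≫ X.str = t ≫ Y.str := by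
  rw [← h, Category.assoc, Loc.w]

/-- The forgetful functor from a local clan preserves the base changes of fibrations. -/
theorem Loc.isPullback_left {A : C} {W X Y Z : Loc A} {a : W ⟶ X} {b : W ⟶ Y} {p : X ⟶ Z}
    {q : Y ⟶ Z} (h : IsPullback a b p q) (hp : fib p.left) :
    IsPullback a.left b.left p.left q.left := by
  have := carrable p.left q.left hp
  have sq := IsPullback.of_hasPullback p.left q.left
  have hw : pullback.fst p.left q.left ≫ X.str = pullback.snd p.left q.left ≫ Y.str := by
    rw [← Loc.w p, ← Loc.w q, ← Category.assoc, sq.w, Category.assoc]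
  let V : Loc A :=
    Loc.mk (pullback.snd p.left q.left ≫ Y.str) (fib_comp _ _ (fib_baseChange sq hp) Y.prop)
  let a' : V ⟶ X := Loc.homMk (pullback.fst p.left q.left) hw
  let b' : V ⟶ Y := Loc.homMk (pullback.snd p.left q.left) rfl
  have h' : IsPullback a' b' p q := Loc.isPullback sq
  let e : W ≅ V := h.isoIsPullback _ _ h'
  have h1 : e.hom ≫ a' = a := h.isoIsPullback_hom_fst _ _ h'
  have h2 : e.hom ≫ b' = b := h.isoIsPullback_hom_snd _ _ h'
  exact sq.of_iso' (@asIso _ _ _ _ e.hom.left (Loc.isIso_left e.hom)) (Iso.refl _) (Iso.refl _)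
    (Iso.refl _)
    ((congrArg (fun t => t.left) h1).trans (Category.comp_id _).symm)
    ((congrArg (fun t => t.left) h2).trans (Category.comp_id _).symm)
    (by simp) (by simp)

/-- The unique map from an object of the local clan at `A` to the terminal object `𝟙 A`. -/
abbrev Loc.toId {A : C} (X : Loc A) : X ⟶ Loc.mk (𝟙 A) (MorphismProperty.id_mem _ A) :=
  Loc.homMk X.str (Category.comp_id X.str)

/-- Binary products in the local clan at `A` are fiber products over `A`. -/
theorem Loc.nonempty_isLimit_binaryFan_iff {A : C} {W X Y : Loc A} (a : W ⟶ X) (b : W ⟶ Y) :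
    Nonempty (IsLimit (BinaryFan.mk a b)) ↔ IsPullback a.left b.left X.str Y.str := by
  let T : IsTerminal (Loc.mk (𝟙 A) (MorphismProperty.id_mem _ A)) :=
    MorphismProperty.Over.mkIdTerminal (fib : MorphismProperty C) A
  constructor
  · rintro ⟨h⟩
    have sq : IsPullback a b X.toId Y.toId := by
      have := IsPullback.of_is_product' h T
      rwa [T.hom_ext (T.from X) X.toId, T.hom_ext (T.from Y) Y.toId] at this
    exact Loc.isPullback_left sq X.prop
  · intro h
    have sq : IsPullback a b X.toId Y.toId := Loc.isPullback h
    exact ⟨isProductOfIsTerminalIsPullback _ _ _ _ T sq.isLimit⟩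

/-- The identity of `A` is terminal in the local clan at `A`, so the structure map of any terminal
object is invertible. -/
theorem Loc.isIso_str_of_isTerminal {A : C} {X : Loc A} (hX : IsTerminal X) : IsIso X.str := by
  let T : IsTerminal (Loc.mk (𝟙 A) (MorphismProperty.id_mem _ A)) :=
    MorphismProperty.Over.mkIdTerminal (fib : MorphismProperty C) A
  have h : X.toId = (hX.uniqueUpToIso T).hom := T.hom_ext _ _
  have : IsIso X.toId := h ▸ inferInstance
  exact Loc.isIso_left X.toId

/-- An object of a local clan is terminal if its structure map is invertible. -/
theorem Loc.nonempty_isTerminal {A : C} {X : Loc A} (hX : IsIso X.str) :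
    Nonempty (IsTerminal X) :=
  ⟨IsTerminal.ofUniqueHom
    (fun Y => Loc.homMk (Y.str ≫ inv X.str) (by simp))
    (fun Y m => Loc.ext ((IsIso.eq_comp_inv X.str).2 (Loc.w m)))⟩

end LocalPullbacks

section LocalProducts

variable {C : Type u₁} [Category.{v₁} C] [Clan C]
variable {D : Type u₂} [Category.{v₂} D] [Clan D]

/-- The functors induced on local clans by a morphism of clans preserve finite products, because
these are iterated base changes of fibrations. -/
theorem IsClanHom.preservesFiniteProducts_loc {F : C ⥤ D} (hF : IsClanHom F) (A : C) :
    PreservesFiniteProducts (hF.loc A) := by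
  have h₀ : PreservesLimit (Functor.empty.{0} (Loc A)) (hF.loc A) := by
    let T : IsTerminal (Loc.mk (𝟙 A) (MorphismProperty.id_mem _ A)) :=
      MorphismProperty.Over.mkIdTerminal (fib : MorphismProperty C) A
    have : IsIso (Loc.str ((hF.loc A).obj (Loc.mk (𝟙 A) (MorphismProperty.id_mem _ A)))) :=
      inferInstanceAs (IsIso (F.map (𝟙 A)))
    exact preservesLimit_of_preserves_limit_cone T
      ((isLimitMapConeEmptyConeEquiv (hF.loc A) _).symm (Loc.nonempty_isTerminal this).some)
  have h₁ : PreservesLimitsOfShape (Discrete PEmpty.{1}) (hF.loc A) :=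
    preservesLimitsOfShape_pempty_of_preservesTerminal _
  have h₂ : PreservesLimitsOfShape (Discrete WalkingPair) (hF.loc A) := by
    refine ⟨fun {K} => ?_⟩
    suffices PreservesLimit (pair (K.obj ⟨.left⟩) (K.obj ⟨.right⟩)) (hF.loc A) from
      preservesLimit_of_iso_diagram _ (diagramIsoPair K).symm
    have hl := prodIsProd (K.obj ⟨.left⟩) (K.obj ⟨.right⟩)
    have sq := (Loc.nonempty_isLimit_binaryFan_iff _ _).1 ⟨hl⟩
    exact preservesLimit_of_preserves_limit_cone hl
      ((isLimitMapConeBinaryFanEquiv _ _ _).symm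
        ((Loc.nonempty_isLimit_binaryFan_iff _ _).2
          (hF.map_isPullback (K.obj ⟨.left⟩).prop sq)).some)
  have : HasFiniteProducts (Loc A) := hasFiniteProducts_of_has_binary_and_terminal
  exact .of_preserves_binary_and_terminal _

end LocalProducts

/-! ### Exponentials over a base -/

section ExponentialOver

variable {C : Type u₁} [Category.{v₁} C]

/-- `IsExponentialOver S p x y fst snd ε` says that `(P, p)`, with the evaluation
`ε : P ×_B X ⟶ Y` over `B`, is an exponential of `(Y, y)` by `(X, x)` over `B`, as far as the
universal property with respect to the objects `(Z, z)` over `B` with `z` in `S` is concerned.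
Here `P ×_B X` is any fiber product `Q`, with projections `fst` and `snd`. For `S = fib` this
expresses exponentials of the local clan at `B`, and for `S = ⊤` those of the slice over `B`. -/
structure IsExponentialOver (S : MorphismProperty C) {B P Q X Y : C} (p : P ⟶ B) (x : X ⟶ B)
    (y : Y ⟶ B) (fst : Q ⟶ P) (snd : Q ⟶ X) (ε : Q ⟶ Y) : Prop where
  isPullback : IsPullback fst snd p x
  eval_comp : ε ≫ y = snd ≫ x
  existsUnique : ∀ {Z V : C} (z : Z ⟶ B) (c₁ : V ⟶ Z) (c₂ : V ⟶ X), S z →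
    IsPullback c₁ c₂ z x → ∀ u : V ⟶ Y, u ≫ y = c₂ ≫ x →
      ∃! v : Z ⟶ P, v ≫ p = z ∧ ∃ w : V ⟶ Q, w ≫ fst = c₁ ≫ v ∧ w ≫ snd = c₂ ∧ w ≫ ε = u

namespace IsExponentialOver

variable {B P Q X Y : C} {p : P ⟶ B} {x : X ⟶ B} {y : Y ⟶ B} {fst : Q ⟶ P} {snd : Q ⟶ X}
  {ε : Q ⟶ Y}

theorem mono {S S' : MorphismProperty C} (hS : S' ≤ S)
    (h : IsExponentialOver S p x y fst snd ε) : IsExponentialOver S' p x y fst snd ε where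
  isPullback := h.isPullback
  eval_comp := h.eval_comp
  existsUnique z c₁ c₂ hz hc u hu := h.existsUnique z c₁ c₂ (hS _ hz) hc u hu

/-- An internal product of `X ×_B Y ⟶ X` along `x : X ⟶ B` is an exponential of `(Y, y)` by
`(X, x)` over `B`. -/
theorem of_isInternalProduct {E : C} {e₁ : E ⟶ X} {e₂ : E ⟶ Y} {ε' : Q ⟶ E}
    (hE : IsPullback e₁ e₂ x y) (h : IsInternalProduct e₁ x p fst snd ε') :
    IsExponentialOver ⊤ p x y fst snd (ε' ≫ e₂) where
  isPullback := h.isPullback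
  eval_comp := by rw [Category.assoc, ← hE.w, ← Category.assoc, h.eval_comp]
  existsUnique z c₁ c₂ _ hc u hu := by
    obtain ⟨v, ⟨hv, w, w1, w2, w3⟩, huniq⟩ :=
      h.existsUnique z c₁ c₂ hc (hE.lift c₂ u hu.symm) (hE.lift_fst _ _ _)
    refine ⟨v, ⟨hv, w, w1, w2, by rw [← Category.assoc, w3, hE.lift_snd]⟩, ?_⟩
    rintro v' ⟨hv', w', w1', w2', w3'⟩
    refine huniq v' ⟨hv', w', w1', w2', hE.hom_ext ?_ ?_⟩
    · rw [Category.assoc, h.eval_comp, w2', hE.lift_fst]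
    · rw [Category.assoc, w3', hE.lift_snd]

/-- Two exponentials of the same objects are isomorphic, so that the stronger of the two universal
properties holds for both as soon as it holds for one. -/
theorem of_comparison {S S' : MorphismProperty C} {P' Q' : C} {p' : P' ⟶ B} {fst' : Q' ⟶ P'}
    {snd' : Q' ⟶ X} {ε' : Q' ⟶ Y} (h : IsExponentialOver S p x y fst snd ε)
    (h' : IsExponentialOver S' p' x y fst' snd' ε') (hS : S ≤ S') (hp : S p) (hp' : S p') :
    IsExponentialOver S' p x y fst snd ε where
  isPullback := h.isPullback
  eval_comp := h.eval_comp
  existsUnique {Z V} z c₁ c₂ hz hc u hu := by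
    obtain ⟨ψ, ⟨ψ0, χ, χ1, χ2, χ3⟩, -⟩ :=
      h'.existsUnique p fst snd (hS _ hp) h.isPullback ε h.eval_comp
    obtain ⟨φ, ⟨φ0, θ, θ1, θ2, θ3⟩, -⟩ :=
      h.existsUnique p' fst' snd' hp' h'.isPullback ε' h'.eval_comp
    have key : ψ ≫ φ = 𝟙 P := by
      refine (h.existsUnique p fst snd hp h.isPullback ε h.eval_comp).unique
        ⟨?_, χ ≫ θ, ?_, ?_, ?_⟩ ⟨Category.id_comp _, 𝟙 _, by simp, by simp, by simp⟩
      · rw [Category.assoc, φ0, ψ0]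
      · rw [Category.assoc, θ1, ← Category.assoc, χ1, Category.assoc]
      · rw [Category.assoc, θ2, χ2]
      · rw [Category.assoc, θ3, χ3]
    obtain ⟨v, ⟨v0, w, w1, w2, w3⟩, huniq⟩ := h'.existsUnique z c₁ c₂ hz hc u hu
    refine ⟨v ≫ φ, ⟨?_, w ≫ θ, ?_, ?_, ?_⟩, ?_⟩
    · rw [Category.assoc, φ0, v0]
    · rw [Category.assoc, θ1, ← Category.assoc, w1, Category.assoc]
    · rw [Category.assoc, θ2, w2]
    · rw [Category.assoc, θ3, w3]
    · rintro t ⟨t0, s, s1, s2, s3⟩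
      have := huniq (t ≫ ψ) ⟨by rw [Category.assoc, ψ0, t0], s ≫ χ,
        by rw [Category.assoc, χ1, ← Category.assoc, s1, Category.assoc],
        by rw [Category.assoc, χ2, s2], by rw [Category.assoc, χ3, s3]⟩
      rw [← this, Category.assoc, key, Category.comp_id]

/-- Exponentials of slices are stable under base change: a map over `B'` from `(Z, z)` to the base
change of `(P, p)` along `g : B' ⟶ B` is a map over `B` from `(Z, z ≫ g)` to `(P, p)`, and
`Z ×_{B'} X'` is also a fiber product of `Z` and `X` over `B`. -/
theorem baseChange {B' P' Q' X' Y' : C} {p' : P' ⟶ B'} {x' : X' ⟶ B'} {y' : Y' ⟶ B'}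
    {fst' : Q' ⟶ P'} {snd' : Q' ⟶ X'} {ε' : Q' ⟶ Y'} {g : B' ⟶ B} {gP : P' ⟶ P} {gQ : Q' ⟶ Q}
    {gX : X' ⟶ X} {gY : Y' ⟶ Y} (h : IsExponentialOver ⊤ p x y fst snd ε)
    (hP : IsPullback gP p' p g) (hX : IsPullback gX x' x g) (hY : IsPullback gY y' y g)
    (hQ : IsPullback fst' snd' p' x') (h₁ : fst' ≫ gP = gQ ≫ fst) (h₂ : snd' ≫ gX = gQ ≫ snd)
    (h₃ : ε' ≫ gY = gQ ≫ ε) (h₄ : ε' ≫ y' = snd' ≫ x') :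
    IsExponentialOver ⊤ p' x' y' fst' snd' ε' where
  isPullback := hQ
  eval_comp := h₄
  existsUnique {Z V} z c₁ c₂ _ hc u hu := by
    obtain ⟨v, ⟨v0, w, w1, w2, w3⟩, huniq⟩ := h.existsUnique (z ≫ g) c₁ (c₂ ≫ gX) trivial
      (hc.flip.paste_horiz hX.flip.flip |>.flip) (u ≫ gY)
      (by rw [Category.assoc, hY.w, ← Category.assoc, hu, Category.assoc, Category.assoc, hX.w])
    have hw' : (c₁ ≫ hP.lift v z v0) ≫ p' = c₂ ≫ x' := by
      rw [Category.assoc, hP.lift_snd, hc.w]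
    have hwQ : hQ.lift (c₁ ≫ hP.lift v z v0) c₂ hw' ≫ gQ = w := by
      refine h.isPullback.hom_ext ?_ ?_
      · rw [Category.assoc, ← h₁, ← Category.assoc, hQ.lift_fst, Category.assoc, hP.lift_fst, w1]
      · rw [Category.assoc, ← h₂, ← Category.assoc, hQ.lift_snd, w2]
    refine ⟨hP.lift v z v0, ⟨hP.lift_snd _ _ _, hQ.lift (c₁ ≫ hP.lift v z v0) c₂ hw',
      hQ.lift_fst _ _ _, hQ.lift_snd _ _ _, hY.hom_ext ?_ ?_⟩, ?_⟩
    · rw [Category.assoc, h₃, ← Category.assoc, hwQ, w3]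
    · rw [Category.assoc, h₄, ← Category.assoc, hQ.lift_snd, hu]
    · rintro t ⟨t0, s, s1, s2, s3⟩
      have := huniq (t ≫ gP) ⟨by rw [Category.assoc, hP.w, ← Category.assoc, t0], s ≫ gQ,
        by rw [Category.assoc, ← h₁, ← Category.assoc, s1, Category.assoc],
        by rw [Category.assoc, ← h₂, ← Category.assoc, s2],
        by rw [Category.assoc, ← h₃, ← Category.assoc, s3]⟩
      exact hP.hom_ext (by rw [this, hP.lift_fst]) (by rw [t0, hP.lift_snd])

end IsExponentialOver

end ExponentialOver

section LocalExponentials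

variable {C : Type u₁} [Category.{v₁} C] [Clan C]

/-- Exponentials of the local clan at `B`, in terms of the underlying category. -/
theorem Loc.isExponential_iff {B : C} {P Q X Y : Loc B} {fst : Q ⟶ P} {snd : Q ⟶ X}
    {ε : Q ⟶ Y} : IsExponential fst snd ε ↔
      IsExponentialOver fib P.str X.str Y.str fst.left snd.left ε.left := by
  constructor
  · intro h
    have hQ := (Loc.nonempty_isLimit_binaryFan_iff _ _).1 h.isProduct
    refine ⟨hQ, by rw [Loc.w, Loc.w], fun {Z V} z c₁ c₂ hz hc u hu => ?_⟩
    let Z' : Loc B := Loc.mk z hz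
    let V' : Loc B := Loc.mk (c₁ ≫ z) (fib_comp _ _ (fib_baseChange hc.flip X.prop) hz)
    let c₁' : V' ⟶ Z' := Loc.homMk c₁ rfl
    let c₂' : V' ⟶ X := Loc.homMk c₂ hc.w.symm
    let u' : V' ⟶ Y := Loc.homMk u (hu.trans hc.w.symm)
    obtain ⟨v, ⟨w, w1, w2, w3⟩, huniq⟩ := h.existsUnique c₁' c₂'
      ((Loc.nonempty_isLimit_binaryFan_iff c₁' c₂').2 hc).some u'
    refine ⟨v.left, ⟨Loc.w v, w.left, congrArg (fun t => t.left) w1,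
      congrArg (fun t => t.left) w2, congrArg (fun t => t.left) w3⟩, ?_⟩
    rintro t ⟨t0, s, s1, s2, s3⟩
    let t' : Z' ⟶ P := Loc.homMk t t0
    let s' : V' ⟶ Q := Loc.homMk s
      ((Loc.comp_str fst s1).trans ((Category.assoc _ _ _).trans (congrArg (c₁ ≫ ·) t0)))
    exact congrArg (fun t => t.left)
      (huniq t' ⟨s', Loc.ext s1, Loc.ext s2, Loc.ext s3⟩)
  · intro h
    refine ⟨(Loc.nonempty_isLimit_binaryFan_iff _ _).2 h.isPullback, fun {Z V} c₁ c₂ hc u => ?_⟩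
    have hc := (Loc.nonempty_isLimit_binaryFan_iff _ _).1 ⟨hc⟩
    obtain ⟨v, ⟨v0, w, w1, w2, w3⟩, huniq⟩ := h.existsUnique Z.str c₁.left c₂.left Z.prop hc u.left
      (by rw [Loc.w, Loc.w])
    refine ⟨Loc.homMk v v0, ⟨Loc.homMk w ?_, Loc.ext w1, Loc.ext w2, Loc.ext w3⟩, ?_⟩
    · rw [← Loc.w fst, ← Category.assoc, w1, Category.assoc, v0, Loc.w]
    · rintro t ⟨s, s1, s2, s3⟩
      exact Loc.ext (huniq t.left ⟨Loc.w t, s.left, congrArg (fun t => t.left) s1,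
        congrArg (fun t => t.left) s2, congrArg (fun t => t.left) s3⟩)

/-- In a π-clan, exponentials of local clans are exponentials of slices: an internal product
provides one that is. -/
theorem IsExponentialOver.of_isPiClan [IsPiClan C] {B P Q X Y : C} {p : P ⟶ B} {x : X ⟶ B}
    {y : Y ⟶ B} {fst : Q ⟶ P} {snd : Q ⟶ X} {ε : Q ⟶ Y} (hp : fib p) (hx : fib x) (hy : fib y)
    (h : IsExponentialOver fib p x y fst snd ε) : IsExponentialOver ⊤ p x y fst snd ε := by
  have := carrable x y hx
  have sq := IsPullback.of_hasPullback x y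
  obtain ⟨P', Q', p', π₁, π₂, ε', h', hp'⟩ :=
    IsPiClan.exists_internalProduct (pullback.fst x y) x (fib_baseChange sq.flip hy) hx
  exact h.of_comparison (.of_isInternalProduct sq h') le_top hp hp'

/-- An exponential of a slice of `C`, between objects over `A`, is an exponential in the iterated
local clan. -/
theorem Loc.isExponentialOver_of_left {A : C} {B P Q X Y : Loc A} {p : P ⟶ B} {x : X ⟶ B}
    {y : Y ⟶ B} {fst : Q ⟶ P} {snd : Q ⟶ X} {ε : Q ⟶ Y} (hx : fib x)
    (h : IsExponentialOver fib p.left x.left y.left fst.left snd.left ε.left) :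
    IsExponentialOver fib p x y fst snd ε where
  isPullback := Loc.isPullback h.isPullback
  eval_comp := Loc.ext h.eval_comp
  existsUnique {Z V} z c₁ c₂ hz hc u hu := by
    have hc' := (Loc.isPullback_left hc.flip hx).flip
    obtain ⟨v, ⟨v0, w, w1, w2, w3⟩, huniq⟩ := h.existsUnique z.left c₁.left c₂.left hz hc' u.left
      (congrArg (fun t => t.left) hu)
    refine ⟨Loc.homMk v ?_, ⟨Loc.ext v0, Loc.homMk w ?_, Loc.ext w1, Loc.ext w2, Loc.ext w3⟩, ?_⟩
    · rw [← Loc.w p, ← Category.assoc, v0, Loc.w]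
    · rw [← Loc.w snd, ← Category.assoc, w2, Loc.w]
    · rintro t ⟨t0, s, s1, s2, s3⟩
      exact Loc.ext (huniq t.left ⟨congrArg (fun t => t.left) t0, s.left,
        congrArg (fun t => t.left) s1, congrArg (fun t => t.left) s2,
        congrArg (fun t => t.left) s3⟩)

/-- The exponentials of the iterated local clan at `B`, where `B` is an object of the local clan at
`A`, are those of the local clan at the domain of `B`. -/
theorem Loc.isExponentialOver_left {A : C} {B P Q X Y : Loc A} {p : P ⟶ B} {x : X ⟶ B}
    {y : Y ⟶ B} {fst : Q ⟶ P} {snd : Q ⟶ X} {ε : Q ⟶ Y} (hx : fib x)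
    (h : IsExponentialOver fib p x y fst snd ε) :
    IsExponentialOver fib p.left x.left y.left fst.left snd.left ε.left where
  isPullback := (Loc.isPullback_left h.isPullback.flip hx).flip
  eval_comp := congrArg (fun t => t.left) h.eval_comp
  existsUnique {Z V} z c₁ c₂ hz hc u hu := by
    let Z' : Loc A := Loc.mk (z ≫ B.str) (fib_comp _ _ hz B.prop)
    let V' : Loc A := Loc.mk (c₁ ≫ z ≫ B.str) (fib_comp _ _ (fib_baseChange hc.flip hx) Z'.prop)
    let z' : Z' ⟶ B := Loc.homMk z rfl
    let c₁' : V' ⟶ Z' := Loc.homMk c₁ rfl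
    let c₂' : V' ⟶ X := Loc.homMk c₂
      ((Loc.comp_str x hc.w.symm).trans (Category.assoc _ _ _))
    let u' : V' ⟶ Y := Loc.homMk u
      ((Loc.comp_str y (hu.trans hc.w.symm)).trans (Category.assoc _ _ _))
    have hc' : IsPullback c₁' c₂' z' x := Loc.isPullback hc
    obtain ⟨v, ⟨v0, w, w1, w2, w3⟩, huniq⟩ := h.existsUnique z' c₁' c₂' hz hc' u' (Loc.ext hu)
    refine ⟨v.left, ⟨congrArg (fun t => t.left) v0, w.left, congrArg (fun t => t.left) w1,
      congrArg (fun t => t.left) w2, congrArg (fun t => t.left) w3⟩, ?_⟩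
    rintro t ⟨t0, s, s1, s2, s3⟩
    let t' : Z' ⟶ P := Loc.homMk t (Loc.comp_str p t0)
    let s' : V' ⟶ Q := Loc.homMk s ((Loc.comp_str fst s1).trans
      ((Category.assoc _ _ _).trans (congrArg (c₁ ≫ ·) (Loc.w t'))))
    exact congrArg (fun t => t.left)
      (huniq t' ⟨Loc.ext t0, s', Loc.ext s1, Loc.ext s2, Loc.ext s3⟩)

end LocalExponentials

/-! ### Morphisms of π-clans and exponentials over a base -/

section PiClosed

variable {C : Type u₁} [Category.{v₁} C] [Clan C]
variable {D : Type u₂} [Category.{v₂} D] [Clan D]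

theorem IsPiClosed.map_isExponentialOver {F : C ⥤ D} (hF : IsPiClosed F) {B P Q X Y : C}
    {p : P ⟶ B} {x : X ⟶ B} {y : Y ⟶ B} {fst : Q ⟶ P} {snd : Q ⟶ X} {ε : Q ⟶ Y}
    (hp : fib p) (hx : fib x) (hy : fib y) (h : IsExponentialOver fib p x y fst snd ε) :
    IsExponentialOver fib (F.map p) (F.map x) (F.map y) (F.map fst) (F.map snd) (F.map ε) := by
  let Q' : Loc B := Loc.mk (fst ≫ p) (fib_comp _ _ (fib_baseChange h.isPullback.flip hx) hp)
  let fst' : Q' ⟶ Loc.mk p hp := Loc.homMk fst rfl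
  let snd' : Q' ⟶ Loc.mk x hx := Loc.homMk snd h.isPullback.w.symm
  let ε' : Q' ⟶ Loc.mk y hy := Loc.homMk ε (h.eval_comp.trans h.isPullback.w.symm)
  have h' : IsExponential fst' snd' ε' := Loc.isExponential_iff.2 h
  exact Loc.isExponential_iff.1 ((hF.loc_isCartesianClosed B).map_isExponential h')

/-- Finite products of local clans being preserved by all morphisms of clans, a morphism of clans
is π-closed if it preserves the exponentials of local clans. -/
theorem IsClanHom.isPiClosed {F : C ⥤ D} (hF : IsClanHom F)
    (h : ∀ {B P Q X Y : C} {p : P ⟶ B} {x : X ⟶ B} {y : Y ⟶ B} {fst : Q ⟶ P} {snd : Q ⟶ X}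
      {ε : Q ⟶ Y}, fib p → fib x → fib y → IsExponentialOver fib p x y fst snd ε →
        IsExponentialOver fib (F.map p) (F.map x) (F.map y) (F.map fst) (F.map snd) (F.map ε)) :
    IsPiClosed F where
  isClanHom := hF
  loc_isCartesianClosed A :=
    { preservesFiniteProducts := hF.preservesFiniteProducts_loc A
      map_isExponential {P _ X Y _ _ _} he := Loc.isExponential_iff.2
        (h P.prop X.prop Y.prop (Loc.isExponential_iff.1 he)) }

end PiClosed

/-! ### Local clans of a π-clan -/

section LocalPiClan

variable {C : Type u₁} [Category.{v₁} C] [Clan C]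

/-- Internal products in a local clan are those of the underlying clan, since maps over an object
of the local clan at `A` are automatically maps over `A`. -/
theorem Loc.isPiClan [IsPiClan C] (A : C) : IsPiClan (Loc A) where
  exists_internalProduct {E X Y} p f hp hf := by
    obtain ⟨P, Q, q, π₁, π₂, ε, h, hq⟩ :=
      IsPiClan.exists_internalProduct p.left f.left hp hf
    let P' : Loc A := Loc.mk (q ≫ Y.str) (fib_comp _ _ hq Y.prop)
    let Q' : Loc A := Loc.mk (π₂ ≫ X.str) (fib_comp _ _ (fib_baseChange h.isPullback hq) X.prop)
    let q' : P' ⟶ Y := Loc.homMk q rfl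
    let π₁' : Q' ⟶ P' := Loc.homMk π₁ (by
      change π₁ ≫ q ≫ Y.str = π₂ ≫ X.str
      rw [← Category.assoc, h.isPullback.w, Category.assoc, Loc.w])
    let π₂' : Q' ⟶ X := Loc.homMk π₂ rfl
    let ε' : Q' ⟶ E := Loc.homMk ε (Loc.comp_str p h.eval_comp)
    refine ⟨P', Q', q', π₁', π₂', ε', ⟨Loc.isPullback h.isPullback, Loc.ext h.eval_comp,
      fun {Z W} g c₁ c₂ hc u hu => ?_⟩, hq⟩
    obtain ⟨v, ⟨v0, w, w1, w2, w3⟩, huniq⟩ := h.existsUnique g.left c₁.left c₂.left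
      (Loc.isPullback_left hc.flip hf).flip u.left (congrArg (fun t => t.left) hu)
    refine ⟨Loc.homMk v ?_, ⟨Loc.ext v0, Loc.homMk w ?_, Loc.ext w1, Loc.ext w2, Loc.ext w3⟩, ?_⟩
    · change v ≫ q ≫ Y.str = _
      rw [← Category.assoc, v0, Loc.w]
    · change w ≫ π₂ ≫ X.str = _
      rw [← Category.assoc, w2, Loc.w]
    · rintro t ⟨t0, s, s1, s2, s3⟩
      exact Loc.ext (huniq t.left ⟨congrArg (fun t => t.left) t0, s.left,
        congrArg (fun t => t.left) s1, congrArg (fun t => t.left) s2,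
        congrArg (fun t => t.left) s3⟩)

end LocalPiClan

/-! ### The base change functor -/

section BaseChange

variable {C : Type u₁} [Category.{v₁} C] [Clan C]

theorem isPullback_snd_map_id (A : C) {X Y : C} (f : X ⟶ Y) :
    IsPullback prod.snd (prod.map (𝟙 A) f) f (prod.snd : A ⨯ Y ⟶ Y) := by
  refine .mk' (prod.map_snd _ _).symm (fun T φ φ' h₁ h₂ => ?_) (fun T a b h => ?_)
  · ext
    · have := congrArg (· ≫ prod.fst) h₂
      simpa only [Category.assoc, prod.map_fst, Category.comp_id] using this
    · exact h₁
  · refine ⟨prod.lift (b ≫ prod.fst) a, prod.lift_snd _ _, ?_⟩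
    rw [prod.lift_map, Category.comp_id]
    ext
    · rw [prod.lift_fst]
    · rw [prod.lift_snd, h]

theorem baseChange_isClanHom (A : C) : IsClanHom (baseChange A) where
  map_fib f hf := Clan.fib_baseChange (C := C) (isPullback_snd_map_id A f) hf
  map_isPullback {W X A' B p₂ p₁ p f} _ h := by
    refine Loc.isPullback (IsPullback.of_right ?_ ?_ (isPullback_snd_map_id A p))
    · change IsPullback (prod.map (𝟙 A) p₂ ≫ prod.snd) (prod.map (𝟙 A) p₁) p
        (prod.map (𝟙 A) f ≫ prod.snd)
      rw [prod.map_snd, prod.map_snd]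
      exact (isPullback_snd_map_id A p₁).paste_horiz h
    · exact congrArg (fun t => t.left) (((baseChange A).map_comp p₂ p).symm.trans
        ((congrArg (baseChange A).map h.w).trans ((baseChange A).map_comp p₁ f)))
  map_terminal {T} hT := by
    refine Loc.nonempty_isTerminal ⟨prod.lift (𝟙 A) (hT.from A), ?_, ?_⟩
    · change (prod.fst : A ⨯ T ⟶ A) ≫ prod.lift (𝟙 A) (hT.from A) = 𝟙 _
      ext
      · rw [Category.assoc, prod.lift_fst, Category.comp_id, Category.id_comp]
      · exact hT.hom_ext _ _
    · exact prod.lift_fst _ _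

theorem baseChange_isPiClosed [IsPiClan C] (A : C) : IsPiClosed (baseChange A) :=
  (baseChange_isClanHom A).isPiClosed fun {_ _ _ _ _ p x y _ snd ε} hp hx hy h => by
    refine Loc.isExponentialOver_of_left ((baseChange_isClanHom A).map_fib x hx) ?_
    exact ((h.of_isPiClan hp hx hy).baseChange (isPullback_snd_map_id A p)
      (isPullback_snd_map_id A x) (isPullback_snd_map_id A y)
      (Loc.isPullback_left ((baseChange_isClanHom A).map_isPullback hp h.isPullback)
        ((baseChange_isClanHom A).map_fib p hp))
      (gQ := prod.snd) (prod.map_snd _ _) (prod.map_snd _ _) (prod.map_snd _ _)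
      (congrArg (fun t => t.left) (((baseChange A).map_comp ε y).symm.trans
        ((congrArg (baseChange A).map h.eval_comp).trans
          ((baseChange A).map_comp snd x))))).mono le_top

end BaseChange

/-! ### The fiber of a morphism of clans at an element -/

section Fiber

variable {C : Type u₁} [Category.{v₁} C] [Clan C]
variable {R : Type u₂} [Category.{v₂} R] [Clan R]
variable {F : C ⥤ R} (hF : IsClanHom F) {A : C} (a : ⊤_ R ⟶ F.obj A)

theorem IsClanHom.hasPullback_element {F : C ⥤ R} (hF : IsClanHom F) {A : C}
    (a : ⊤_ R ⟶ F.obj A) (X : Loc A) :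
    HasPullback (F.map X.str) a :=
  carrable _ _ (hF.map_fib _ X.prop)

/-- The fiber of `F(X) ⟶ F(A)` at the element `a` of `F(A)`, for an object `X` of the local clan
at `A`. -/
noncomputable def IsClanHom.fiberObj (X : Loc A) : R :=
  have := hF.hasPullback_element a X
  pullback (F.map X.str) a

/-- The canonical map from the fiber of `F(X) ⟶ F(A)` to `F(X)`. -/
noncomputable def IsClanHom.fiberι (X : Loc A) : hF.fiberObj a X ⟶ F.obj X.left :=
  have := hF.hasPullback_element a X
  pullback.fst (F.map X.str) a

theorem IsClanHom.isPullback_fiberι (X : Loc A) :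
    IsPullback (hF.fiberι a X) (terminal.from _) (F.map X.str) a := by
  have := hF.hasPullback_element a X
  have sq := IsPullback.of_hasPullback (F.map X.str) a
  rwa [Subsingleton.elim (pullback.snd (F.map X.str) a) (terminal.from _)] at sq

/-- The functor from the local clan at `A` that sends `(E, p)` to the fiber of `F(p)` at the
element `a` of `F(A)`. -/
noncomputable def IsClanHom.fiber : Loc A ⥤ R where
  obj X := hF.fiberObj a X
  map {X Y} f := (hF.isPullback_fiberι a Y).lift (hF.fiberι a X ≫ F.map f.left) (terminal.from _)
    (by rw [Category.assoc, ← F.map_comp, Loc.w, (hF.isPullback_fiberι a X).w])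
  map_id X := (hF.isPullback_fiberι a X).hom_ext
    (by
      rw [IsPullback.lift_fst, Category.id_comp]
      exact (congrArg _ (F.map_id _)).trans (Category.comp_id _))
    (Subsingleton.elim _ _)
  map_comp {X Y Z} f g := (hF.isPullback_fiberι a Z).hom_ext
    (by
      rw [IsPullback.lift_fst, Category.assoc, IsPullback.lift_fst, ← Category.assoc,
        IsPullback.lift_fst, Category.assoc]
      exact congrArg _ (F.map_comp f.left g.left))
    (Subsingleton.elim _ _)

theorem IsClanHom.fiber_map_fiberι {X Y : Loc A} (f : X ⟶ Y) :
    (hF.fiber a).map f ≫ hF.fiberι a Y = hF.fiberι a X ≫ F.map f.left :=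
  IsPullback.lift_fst _ _ _ _

theorem IsClanHom.fiber_map_fiberι_snd {X : Loc A} {Y : C} (f : X ⟶ (baseChange A).obj Y) :
    (hF.fiber a).map f ≫ (hF.fiberι a ((baseChange A).obj Y) ≫ F.map (prod.snd : A ⨯ Y ⟶ Y)) =
      hF.fiberι a X ≫ F.map (f.left ≫ (prod.snd : A ⨯ Y ⟶ Y)) :=
  (Category.assoc _ _ _).symm.trans
    ((congrArg (· ≫ F.map (prod.snd : A ⨯ Y ⟶ Y)) (hF.fiber_map_fiberι a f)).trans
      ((Category.assoc _ _ _).trans (congrArg (hF.fiberι a X ≫ ·) (F.map_comp _ _).symm)))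

theorem IsClanHom.isPullback_fiber_map {X Y : Loc A} (f : X ⟶ Y) :
    IsPullback (hF.fiberι a X) ((hF.fiber a).map f) (F.map f.left) (hF.fiberι a Y) := by
  refine IsPullback.of_bot (v₂₁ := terminal.from _) ?_ (hF.fiber_map_fiberι a f).symm
    (hF.isPullback_fiberι a Y)
  have sq := hF.isPullback_fiberι a X
  rwa [← Loc.w f, F.map_comp, Subsingleton.elim (terminal.from (hF.fiberObj a X))
    ((hF.fiber a).map f ≫ terminal.from (hF.fiberObj a Y))] at sq

theorem IsClanHom.fiber_isClanHom : IsClanHom (hF.fiber a) where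
  map_fib f hf := fib_baseChange (hF.isPullback_fiber_map a f) (hF.map_fib _ hf)
  map_isPullback {W X Y Z p₂ p₁ p f} hp h := by
    refine IsPullback.of_right ?_ ?_ (hF.isPullback_fiber_map a p)
    · rw [hF.fiber_map_fiberι, hF.fiber_map_fiberι]
      exact (hF.isPullback_fiber_map a p₁).paste_horiz
        (hF.map_isPullback hp (Loc.isPullback_left h hp))
    · rw [← Functor.map_comp, h.w, Functor.map_comp]
  map_terminal {T} hT := by
    have := Loc.isIso_str_of_isTerminal hT
    have := (hF.isPullback_fiberι a T).isIso_snd_of_isIso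
    exact ⟨terminalIsTerminal.ofIso (asIso (terminal.from (hF.fiberObj a T))).symm⟩

/-- The fiber functor is the composite of the functor `F_(A)`, which preserves exponentials, and
the base change along `a`, under which exponentials of slices are stable. -/
theorem IsPiClosed.fiber_isPiClosed [IsPiClan R] (hF : IsPiClosed F) :
    IsPiClosed (hF.isClanHom.fiber a) :=
  (hF.isClanHom.fiber_isClanHom a).isPiClosed fun {_ _ _ _ _ p x y fst snd ε} hp hx hy h => by
    have h' := hF.map_isExponentialOver hp hx hy (Loc.isExponentialOver_left hx h)
    have hH := hF.isClanHom.fiber_isClanHom a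
    refine IsExponentialOver.mono le_top (IsExponentialOver.baseChange
      (h'.of_isPiClan (hF.isClanHom.map_fib _ hp) (hF.isClanHom.map_fib _ hx)
        (hF.isClanHom.map_fib _ hy))
      (hF.isClanHom.isPullback_fiber_map a p) (hF.isClanHom.isPullback_fiber_map a x)
      (hF.isClanHom.isPullback_fiber_map a y) (hH.map_isPullback hp h.isPullback)
      (hF.isClanHom.fiber_map_fiberι a fst) (hF.isClanHom.fiber_map_fiberι a snd)
      (hF.isClanHom.fiber_map_fiberι a ε) ?_)
    rw [← Functor.map_comp, h.eval_comp, Functor.map_comp]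

/-- The fiber of `F(A × X) ≅ F(A) × F(X)` over any element of `F(A)` is `F(X)`. -/
theorem IsClanHom.isIso_fiberι_comp_map_snd (X : C) :
    IsIso (hF.fiberι a ((baseChange A).obj X) ≫ F.map (prod.snd : A ⨯ X ⟶ X)) := by
  have h : IsPullback (prod.snd : A ⨯ X ⟶ X) prod.fst (terminal.from X) (terminal.from A) :=
    (IsPullback.of_is_product (prodIsProd A X) terminalIsTerminal).flip
  have sq := (hF.isPullback_fiberι a ((baseChange A).obj X)).paste_horiz
    (hF.map_isPullback (fib_toTerminal X) h)
  obtain ⟨hT⟩ := hF.map_terminal (terminalIsTerminal (C := C))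
  have : IsIso (a ≫ F.map (terminal.from A)) := by
    rw [hT.hom_ext (a ≫ F.map (terminal.from A)) (terminalIsTerminal.uniqueUpToIso hT).hom]
    infer_instance
  exact sq.isIso_fst_of_isIso

/-- The natural isomorphism between `F` and the restriction of its fiber functor along the base
change functor. -/
noncomputable def IsClanHom.baseChangeFiberIso : baseChange A ⋙ hF.fiber a ≅ F :=
  NatIso.ofComponents
    (fun X => @asIso _ _ _ _ _ (hF.isIso_fiberι_comp_map_snd a X))
    (fun {X _} f => (hF.fiber_map_fiberι_snd a ((baseChange A).map f)).trans
      ((congrArg (fun t => hF.fiberι a ((baseChange A).obj X) ≫ F.map t)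
        (prod.map_snd (𝟙 A) f)).trans
        ((congrArg (hF.fiberι a ((baseChange A).obj X) ≫ ·) (F.map_comp _ _)).trans
          (Category.assoc _ _ _).symm)))

theorem IsClanHom.mapElement_diagElement_fiber :
    (hF.fiber_isClanHom a).mapElement (diagElement A) ≫ (hF.baseChangeFiberIso a).hom.app A =
      a := by
  have hd : (diagElement A).left ≫ (prod.snd : A ⨯ A ⟶ A) = (⊤_ (Loc A)).str := by
    change ((⊤_ (Loc A)).str ≫ (diag A : A ⟶ A ⨯ A)) ≫ prod.snd = _
    rw [Category.assoc, prod.lift_snd, Category.comp_id]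
  have h : (hF.fiber a).map (diagElement A) ≫ (hF.baseChangeFiberIso a).hom.app A =
      terminal.from _ ≫ a :=
    (hF.fiber_map_fiberι_snd a (diagElement A)).trans
      ((congrArg (fun t => hF.fiberι a (⊤_ (Loc A)) ≫ F.map t) hd).trans
        (hF.isPullback_fiberι a _).w)
  rw [IsClanHom.mapElement, Category.assoc, h, ← Category.assoc,
    Subsingleton.elim (_ ≫ terminal.from _) (𝟙 (⊤_ R)), Category.id_comp]

end Fiber

/-! ### Natural transformations between functors on a local clan -/

section Graph

variable {C : Type u₁} [Category.{v₁} C] [Clan C] {A : C}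

/-- The graph `E ⟶ A × E` of the structure map of an object `(E, p)` of the local clan at `A`,
as a map `(E, p) ⟶ e_A(E)`. -/
noncomputable def Loc.graph (X : Loc A) : X ⟶ (baseChange A).obj X.left :=
  Loc.homMk (prod.lift X.str (𝟙 X.left)) (prod.lift_fst _ _)

theorem Loc.graph_naturality {X Y : Loc A} (f : X ⟶ Y) :
    X.graph ≫ (baseChange A).map f.left = f ≫ Y.graph := by
  refine Loc.ext ?_
  change prod.lift X.str (𝟙 X.left) ≫ prod.map (𝟙 A) f.left = f.left ≫ prod.lift Y.str (𝟙 Y.left)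
  rw [prod.lift_map, prod.comp_lift, Loc.w, Category.comp_id, Category.comp_id, Category.id_comp]

theorem Loc.graph_baseChange (X : C) :
    ((baseChange A).obj X).graph ≫ (baseChange A).map (prod.snd : A ⨯ X ⟶ X) = 𝟙 _ := by
  refine Loc.ext ?_
  change prod.lift (prod.fst : A ⨯ X ⟶ A) (𝟙 (A ⨯ X)) ≫ prod.map (𝟙 A) prod.snd = 𝟙 (A ⨯ X)
  rw [prod.lift_map, Category.id_comp, Category.comp_id]
  ext
  · rw [prod.lift_fst, Category.id_comp]
  · rw [prod.lift_snd, Category.id_comp]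

/-- Every object `(E, p)` of the local clan at `A` is the fiber of `e_A(p)` at the diagonal element
of `e_A(A)`. -/
theorem Loc.isPullback_graph (X : Loc A) :
    IsPullback X.graph (terminal.from X) ((baseChange A).map X.str) (diagElement A) := by
  have hT : IsIso (⊤_ (Loc A)).str := Loc.isIso_str_of_isTerminal terminalIsTerminal
  have hX : (terminal.from X).left ≫ (⊤_ (Loc A)).str = X.str := Loc.w _
  refine Loc.isPullback ?_
  change IsPullback (prod.lift X.str (𝟙 X.left)) (terminal.from X).left (prod.map (𝟙 A) X.str)
    ((⊤_ (Loc A)).str ≫ (diag A : A ⟶ A ⨯ A))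
  refine .mk' ?_ (fun T φ φ' h _ => ?_) (fun T s t h => ⟨s ≫ prod.snd, ?_, ?_⟩)
  · rw [← Category.assoc, hX, prod.lift_map, prod.comp_lift, Category.id_comp, Category.comp_id]
  · have := congrArg (· ≫ prod.snd) h
    simpa only [Category.assoc, prod.lift_snd, Category.comp_id] using this
  all_goals
    have h1 := congrArg (· ≫ prod.fst) h
    have h2 := congrArg (· ≫ prod.snd) h
    simp only [Category.assoc, prod.map_fst, prod.map_snd, prod.lift_fst, prod.lift_snd,
      Category.comp_id] at h1 h2
  · ext
    · rw [Category.assoc, prod.lift_fst, Category.assoc, h2, h1]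
    · rw [Category.assoc, prod.lift_snd, Category.comp_id]
  · rw [← cancel_mono (⊤_ (Loc A)).str, Category.assoc, hX, Category.assoc, h2]

end Graph

section Extension

variable {C : Type u₁} [Category.{v₁} C] [Clan C] {A : C}
variable {R : Type u₂} [Category.{v₂} R] [Clan R] {H K : Loc A ⥤ R}

theorem IsClanHom.isPullback_map_graph (hK : IsClanHom K) (X : Loc A) :
    IsPullback (K.map X.graph) (K.map (terminal.from X)) (K.map ((baseChange A).map X.str))
      (K.map (diagElement A)) :=
  hK.map_isPullback ((baseChange_isClanHom A).map_fib _ X.prop) X.isPullback_graph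

theorem IsClanHom.mono_map_graph (hK : IsClanHom K) (X : Loc A) : Mono (K.map X.graph) :=
  have : Mono (K.map (diagElement A)) := (hK.map_terminal terminalIsTerminal).some.mono_from _
  (hK.isPullback_map_graph X).mono_fst_of_mono

/-- A natural transformation between functors on the local clan at `A`, the codomain of which is a
morphism of clans, is determined by its restriction along the base change functor. -/
theorem IsClanHom.hom_ext_whiskerLeft (hK : IsClanHom K) {φ φ' : H ⟶ K}
    (h : Functor.whiskerLeft (baseChange A) φ = Functor.whiskerLeft (baseChange A) φ') :
    φ = φ' := by
  ext X
  have := hK.mono_map_graph X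
  rw [← cancel_mono (K.map X.graph), ← φ.naturality, ← φ'.naturality]
  exact congrArg (fun t => _ ≫ t) (congrArg (fun t => t.app X.left) h)

/-- The extension of a natural transformation between the restrictions of `H` and `K` along the
base change functor, if it is compatible with the diagonal element, to one from `H` to `K`: the
component at `X` is induced on the fibers at the diagonal element. -/
noncomputable def IsClanHom.extend (hK : IsClanHom K) (α : baseChange A ⋙ H ⟶ baseChange A ⋙ K)
    (t : H.obj (⊤_ (Loc A)) ⟶ K.obj (⊤_ (Loc A)))
    (ht : H.map (diagElement A) ≫ α.app A = t ≫ K.map (diagElement A)) : H ⟶ K where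
  app X := (hK.isPullback_map_graph X).lift (H.map X.graph ≫ α.app X.left)
    (H.map (terminal.from X) ≫ t) (by
      have h := α.naturality X.str
      rw [Functor.comp_map, Functor.comp_map] at h
      rw [Category.assoc, ← h, Category.assoc, ← ht, ← Category.assoc, ← Category.assoc,
        ← H.map_comp, ← H.map_comp, X.isPullback_graph.w])
  naturality {X Y} f := by
    have := hK.mono_map_graph Y
    have h := α.naturality f.left
    rw [Functor.comp_map, Functor.comp_map] at h
    rw [← cancel_mono (K.map Y.graph), Category.assoc, IsPullback.lift_fst, Category.assoc,
      ← K.map_comp, ← Loc.graph_naturality, K.map_comp, ← Category.assoc, ← Category.assoc,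
      ← H.map_comp, ← Loc.graph_naturality, IsPullback.lift_fst, H.map_comp, Category.assoc,
      Category.assoc, h]

theorem IsClanHom.whiskerLeft_extend (hK : IsClanHom K)
    (α : baseChange A ⋙ H ⟶ baseChange A ⋙ K) (t : H.obj (⊤_ (Loc A)) ⟶ K.obj (⊤_ (Loc A)))
    (ht : H.map (diagElement A) ≫ α.app A = t ≫ K.map (diagElement A)) :
    Functor.whiskerLeft (baseChange A) (hK.extend α t ht) = α := by
  ext X
  have h := α.naturality (prod.snd : A ⨯ X ⟶ X)
  rw [Functor.comp_map, Functor.comp_map] at h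
  have h1 : (hK.extend α t ht).app ((baseChange A).obj X) ≫ K.map ((baseChange A).obj X).graph =
      H.map ((baseChange A).obj X).graph ≫ α.app (A ⨯ X) := IsPullback.lift_fst _ _ _ _
  change (hK.extend α t ht).app ((baseChange A).obj X) = α.app X
  calc (hK.extend α t ht).app ((baseChange A).obj X)
      = (hK.extend α t ht).app ((baseChange A).obj X) ≫
          K.map (((baseChange A).obj X).graph ≫ (baseChange A).map prod.snd) := by
        rw [Loc.graph_baseChange, K.map_id, Category.comp_id]
    _ = H.map ((baseChange A).obj X).graph ≫ H.map ((baseChange A).map prod.snd) ≫ α.app X := by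
        rw [K.map_comp, ← Category.assoc, h1]
        exact (Category.assoc _ _ _).trans (congrArg (_ ≫ ·) h.symm)
    _ = α.app X := by
        rw [← Category.assoc, ← H.map_comp, Loc.graph_baseChange, H.map_id, Category.id_comp]

/-- The compatibility of a natural transformation with the images of the diagonal element, freed
from the identifications `H(1) ≅ 1 ≅ K(1)`. -/
theorem IsClanHom.exists_map_diagElement_comp (hH : IsClanHom H) (hK : IsClanHom K)
    (α : baseChange A ⋙ H ⟶ baseChange A ⋙ K)
    (h : hH.mapElement (diagElement A) ≫ α.app A = hK.mapElement (diagElement A)) :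
    ∃ t, H.map (diagElement A) ≫ α.app A = t ≫ K.map (diagElement A) := by
  refine ⟨terminal.from _ ≫ (hK.map_terminal terminalIsTerminal).some.from (⊤_ R), ?_⟩
  rw [Category.assoc]
  change _ = _ ≫ hK.mapElement (diagElement A)
  rw [← h, IsClanHom.mapElement, Category.assoc, ← Category.assoc,
    (hH.map_terminal terminalIsTerminal).some.hom_ext (terminal.from _ ≫ _) (𝟙 _),
    Category.id_comp]

/-- A natural isomorphism between the restrictions of `H` and `K` along the base change functor
extends to one between `H` and `K` if it is compatible with the images of the diagonal element. -/
theorem IsClanHom.exists_isoWhiskerLeft_eq (hH : IsClanHom H) (hK : IsClanHom K)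
    (ψ : baseChange A ⋙ H ≅ baseChange A ⋙ K)
    (h : hH.mapElement (diagElement A) ≫ ψ.hom.app A = hK.mapElement (diagElement A)) :
    ∃ φ : H ≅ K, Functor.isoWhiskerLeft (baseChange A) φ = ψ := by
  obtain ⟨t, ht⟩ := hH.exists_map_diagElement_comp hK ψ.hom h
  obtain ⟨s, hs⟩ := hK.exists_map_diagElement_comp hH ψ.inv (by
    rw [← h]
    exact (Category.assoc _ _ _).trans
      ((congrArg (_ ≫ ·) (ψ.hom_inv_id_app A)).trans (Category.comp_id _)))
  refine ⟨⟨hK.extend ψ.hom t ht, hH.extend ψ.inv s hs,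
    hH.hom_ext_whiskerLeft ?_, hK.hom_ext_whiskerLeft ?_⟩, ?_⟩
  · rw [Functor.whiskerLeft_comp, hK.whiskerLeft_extend, hH.whiskerLeft_extend]
    exact ψ.hom_inv_id
  · rw [Functor.whiskerLeft_comp, hK.whiskerLeft_extend, hH.whiskerLeft_extend]
    exact ψ.inv_hom_id
  · exact Iso.ext (hK.whiskerLeft_extend _ _ ht)

end Extension

/-! ### The universal property of the local clan -/

section Free

variable {C : Type u₁} [Category.{v₁} C] [Clan C] [IsPiClan C] {A : C}
variable {R : Type u₂} [Category.{v₂} R] [Clan R] [IsPiClan R]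

/-- A natural isomorphism compatible with the elements is an isomorphism of `Hom_π(C, R)_A`. -/
def PiHomAt.isoMk {F G : PiHomAt R A} (φ : F.hom.functor ≅ G.hom.functor)
    (h : F.element ≫ φ.hom.app A = G.element) : F ≅ G where
  hom := ⟨φ, h⟩
  inv := ⟨φ.symm, by
    rw [← h, Category.assoc, Iso.symm_hom, Iso.hom_inv_id_app, Category.comp_id]⟩
  hom_inv_id := Subtype.ext φ.self_symm_id
  inv_hom_id := Subtype.ext φ.symm_self_id

theorem isFreelyGeneratedBy_diagElement [IsPiClan (Loc A)] (he : IsPiClosed (baseChange A)) :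
    IsFreelyGeneratedBy.{w₂, w₁} (⟨baseChange A, he⟩ : PiHom C (Loc A)) (diagElement A) := by
  intro R _ _ _
  refine { faithful := ⟨fun {H K} φ φ' h => ?_⟩, full := ⟨fun {H K} ψ => ?_⟩, essSurj := ⟨?_⟩ }
  · refine Iso.ext (K.isPiClosed.isClanHom.hom_ext_whiskerLeft ?_)
    exact congrArg (fun t => t.1.hom) h
  · have hH := H.isPiClosed.isClanHom
    have hK := K.isPiClosed.isClanHom
    obtain ⟨φ, hφ⟩ := hH.exists_isoWhiskerLeft_eq hK ψ.1 ψ.2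
    exact ⟨φ, Subtype.ext hφ⟩
  · rintro ⟨F, a⟩
    have hF := F.isPiClosed
    exact ⟨⟨_, hF.fiber_isPiClosed a⟩,
      ⟨PiHomAt.isoMk (hF.isClanHom.baseChangeFiberIso a)
        (hF.isClanHom.mapElement_diagElement_fiber a)⟩⟩

end Free

end Clan

theorem mainTheorem2 {E : Type u₁} [Category.{v₁} E] [Clan E] [Clan.IsPiClan E] (A : E) :
    ∃ (_ : Clan.IsPiClan (Clan.Loc A)) (he : Clan.IsPiClosed (Clan.baseChange A)),
      Clan.IsFreelyGeneratedBy.{w₂, w₁} (⟨Clan.baseChange A, he⟩ : Clan.PiHom E (Clan.Loc A))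
        (Clan.diagElement A) :=
  have := Clan.Loc.isPiClan A
  ⟨this, Clan.baseChange_isPiClosed A, Clan.isFreelyGeneratedBy_diagElement _⟩
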